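/- Let $k\ge 2$ be an integer, $d=4\cdot 3^{k-1}$, and $$\Delta^{d-1}=\Big\{\mathbf{x}=(x_1,\dots,x_d)\in\mathbb{R}^d : x_i>0 \text{ for all } i,\ \sum_{i=1}^d x_i=1\Big\}.$$ For $j\in\{1,2,3,4\}$ let $I_j=\{(j-1)3^{k-1}+1,\dots,j\,3^{k-1}\}$, $\Sigma_j(\mathbf{x})=\sum_{l\in I_j}x_l$ and $\Sigma_j^i(\mathbf{x})=\sum_{l\in I_j,\,l\ne i}x_l$, and let $\sigma(t)=(1-t)/t$. For $1\le i\le d$ put $j(i)=1,4,3,2$ according as $i\equiv 0,1,2,3 \pmod 4$, and define $$f_i(\mathbf{x})=\sigma(\Sigma_{j(i)}(\mathbf{x}))\,\sigma(x_i),\qquad F^k(\mathbf{x})=\max_{1\le i\le d}f_i(\mathbf{x}),\qquad \alpha_*=\inf_{\mathbf{x}\in\Delta^{d-1}}F^k(\mathbf{x}).$$ In the plane let $\Delta=\{(x,y): x>0,\ y>0,\ x+y<1\}$ and $$f(x,y)=\frac{1-x}{x}\cdot\frac{1-y}{y},\qquad C_f=\{(x,y)\in\Delta: 7x+(18-8\sqrt2)y<3+\sqrt2\},$$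 $$g(x,y)=\frac{1-x-y}{x+y}\cdot\frac{1-y}{y},\qquad C_g=\{(x,y)\in\Delta: x+2y-xy-y^2<3/4\}.$$ With $j=j(i)$, set $$C_{f_i}=\{\mathbf{x}\in\Delta^{d-1}: \Sigma_j^i(\mathbf{x})+2x_i-\Sigma_j^i(\mathbf{x})x_i-x_i^2<3/4\}\quad\text{if } i\in I_j,$$ $$C_{f_i}=\{\mathbf{x}\in\Delta^{d-1}: 7\Sigma_j(\mathbf{x})+(18-8\sqrt2)x_i<3+\sqrt2\}\quad\text{if } i\notin I_j.$$ Then: 1. The infimum $\alpha_*$ is attained on $\Delta^{d-1}$, and every $\mathbf{x}^*\in\Delta^{d-1}$ with $F^k(\mathbf{x}^*)=\alpha_*$ lies in $\bigcap_{i=1}^d C_{f_i}$. 2. The functions $f$ and $g$ are strictly convex on the convex sets $C_f$ and $C_g$. For $\mathbf{x}\in\Delta^{d-1}$ and $j=j(i)$: if $i\notin I_j$, then $f_i(\mathbf{x})=f(\Sigma_j(\mathbf{x}),x_i)$, and $\mathbf{x}\in C_{f_i}$ if and only if $(\Sigma_j(\mathbf{x}),x_i)\in C_f$; if $i\in I_j$,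 then $f_i(\mathbf{x})=g(\Sigma_j^i(\mathbf{x}),x_i)$, and $\mathbf{x}\in C_{f_i}$ if and only if $(\Sigma_j^i(\mathbf{x}),x_i)\in C_g$. In particular each $C_{f_i}$ is convex, $f_i$ is convex on $C_{f_i}$, and $f_i(a\mathbf{x}+b\mathbf{y})<af_i(\mathbf{x})+bf_i(\mathbf{y})$ whenever $\mathbf{x},\mathbf{y}\in C_{f_i}$, $(\Sigma_j(\mathbf{x}),x_i)\ne(\Sigma_j(\mathbf{y}),y_i)$, $a,b>0$ and $a+b=1$. 3. The point at which $F^k$ attains its minimum is unique: if $\mathbf{x}^*,\mathbf{y}^*\in\Delta^{d-1}$ satisfy $F^k(\mathbf{x}^*)=F^k(\mathbf{y}^*)=\alpha_*$, then $\mathbf{x}^*=\mathbf{y}^*$. -/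

import Mathlib

noncomputable section

namespace Displacement

/-- The number `d = 4 * 3 ^ (k - 1)` of variables. -/
abbrev dim (k : ℕ) : ℕ := 4 * 3 ^ (k - 1)

/-- The label in `{1, …, d}` of an index; `Fin d` itself starts at `0`. -/
def label {k : ℕ} (i : Fin (dim k)) : ℕ := (i : ℕ) + 1

/-- The open simplex of points with positive coordinates that add up to `1`. -/
def simplex (k : ℕ) : Set (Fin (dim k) → ℝ) :=
  {x | (∀ i, 0 < x i) ∧ ∑ i, x i = 1}

/-- For `j = 1, 2, 3, 4`, the block `I_j` of the indices with labels
`(j - 1) * 3 ^ (k - 1) + 1, …, j * 3 ^ (k - 1)`. -/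
def block (k j : ℕ) : Finset (Fin (dim k)) :=
  Finset.univ.filter fun i =>
    (j - 1) * 3 ^ (k - 1) < label i ∧ label i ≤ j * 3 ^ (k - 1)

/-- `Σ_j(x)`, the sum of the coordinates in the block `I_j`. -/
def blockSum (k j : ℕ) (x : Fin (dim k) → ℝ) : ℝ := ∑ l ∈ block k j, x l

/-- `Σ_j^i(x)`, the sum of the coordinates in the block `I_j` other than `x_i`. -/
def blockSumErase (k j : ℕ) (i : Fin (dim k)) (x : Fin (dim k) → ℝ) : ℝ :=
  ∑ l ∈ (block k j).erase i, x l

/-- The number `j` of the block that enters the formula of `f_i`; it is determined by the label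
of `i` modulo `4`: the residues `0, 1, 2, 3` give `j = 1, 4, 3, 2`. -/
def blockOf {k : ℕ} (i : Fin (dim k)) : ℕ :=
  if label i % 4 = 0 then 1
  else if label i % 4 = 1 then 4
  else if label i % 4 = 2 then 3
  else 2

/-- `σ(t) = (1 - t) / t`. -/
def sigma (t : ℝ) : ℝ := (1 - t) / t

/-- The displacement function `f_i(x) = σ(Σ_j(x)) σ(x_i)`, where `j = blockOf i`. -/
def disp (k : ℕ) (i : Fin (dim k)) (x : Fin (dim k) → ℝ) : ℝ :=
  sigma (blockSum k (blockOf i) x) * sigma (x i)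

theorem univ_nonempty (k : ℕ) : (Finset.univ : Finset (Fin (dim k))).Nonempty :=
  ⟨⟨0, by positivity⟩, Finset.mem_univ _⟩

/-- `F^k(x) = max (f_1(x), …, f_d(x))`. -/
def maxDisp (k : ℕ) (x : Fin (dim k) → ℝ) : ℝ :=
  Finset.univ.sup' (univ_nonempty k) fun i => disp k i x

/-- `α_*`, the infimum of `F^k` over the simplex. -/
def infMaxDisp (k : ℕ) : ℝ := sInf (maxDisp k '' simplex k)

/-- The region `C_{f_i}`, where `j = blockOf i`. -/
def region (k : ℕ) (i : Fin (dim k)) : Set (Fin (dim k) → ℝ) :=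
  if i ∈ block k (blockOf i) then
    {x | x ∈ simplex k ∧
      blockSumErase k (blockOf i) i x + 2 * x i - blockSumErase k (blockOf i) i x * x i - x i ^ 2
        < 3 / 4}
  else
    {x | x ∈ simplex k ∧
      7 * blockSum k (blockOf i) x + (18 - 8 * √2) * x i < 3 + √2}

/-- The open triangle `Δ` in the plane. -/
def triangle : Set (ℝ × ℝ) := {p | p.1 + p.2 < 1 ∧ 0 < p.1 ∧ 0 < p.2}

/-- `f(x, y) = (1 - x) / x * ((1 - y) / y)`. -/
def planeF (p : ℝ × ℝ) : ℝ := (1 - p.1) / p.1 * ((1 - p.2) / p.2)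

/-- `g(x, y) = (1 - x - y) / (x + y) * ((1 - y) / y)`. -/
def planeG (p : ℝ × ℝ) : ℝ := (1 - p.1 - p.2) / (p.1 + p.2) * ((1 - p.2) / p.2)

/-- The planar region `C_f`. -/
def planeRegionF : Set (ℝ × ℝ) :=
  {p | p ∈ triangle ∧ 7 * p.1 + (18 - 8 * √2) * p.2 < 3 + √2}

/-- The planar region `C_g`. -/
def planeRegionG : Set (ℝ × ℝ) :=
  {p | p ∈ triangle ∧ p.1 + 2 * p.2 - p.1 * p.2 - p.2 ^ 2 < 3 / 4}

end Displacement

end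

/-!
Write `n = 3 ^ (k - 1)` and `α = 12 n - 3`. The function `F^k` has minimum `α`, attained only at the
barycentre, where every coordinate is `1 / (4 n)` and every block sum is `1 / 4`.

Indeed, if `f_i(x) ≤ α` and `S` is the block sum in `f_i`, then clearing denominators gives
`x_i ≥ (1 - S) / (1 + (α - 1) S)`. The right side is a strictly convex function of `S`, so it lies
above its tangent line at `S = 1 / 4`, with equality only at the point of tangency
(`tangent_le_of_sigma_mul_le`). Summed over `i`, the linear terms cancel: each of the four blocks
enters the formulas of exactly `n` functions `f_i` (`sum_blockOf`), and the block sums add up to `1`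
(`sum_blockSum`). The constant terms add up to `1 = ∑ x_i`, so every inequality is an equality and
`x` is the barycentre (`eq_barycentre_of_maxDisp_le`). Attainment, uniqueness, and the location of
the minimiser follow at once.

For convexity, `f` has positive definite Hessian on the convex set `(1 - x) (1 - y) > 1 / 4` of the
unit square (`strictConvexOn_planeF`). This set contains `C_f`, and the shear
`(x, y) ↦ (x + y, y)` carries `g` to `f` and `C_g` into it. Each `f_i` is a linear map followed by
`f` or `g`.
-/

namespace Displacement

/-! ### Convexity in the plane -/

/-- The part of the open unit square where the Hessian of `f` is positive definite. -/
def planeDomain : Set (ℝ × ℝ) :=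
  {p | (0 < p.1 ∧ p.1 < 1) ∧ (0 < p.2 ∧ p.2 < 1) ∧ 1 / 4 < (1 - p.1) * (1 - p.2)}

/-- The superlevel sets of `u v` in the positive quadrant are convex. -/
theorem lt_mul_of_convex_comb {c u v u' v' a b : ℝ} (hc : 0 < c) (hu : 0 < u) (hv : 0 < v)
    (hu' : 0 < u') (hv' : 0 < v') (h : c < u * v) (h' : c < u' * v') (ha : 0 < a) (hb : 0 < b)
    (hab : a + b = 1) : c < (a * u + b * u') * (a * v + b * v') := by
  -- The cross term is at least `2 c`, as `(u v') (u' v) = (u v) (u' v') ≥ c ^ 2`.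
  have hcross : 2 * c ≤ u * v' + u' * v := by
    have h1 : c * c ≤ (u * v) * (u' * v') := mul_le_mul h.le h'.le hc.le (by positivity)
    refine le_of_sq_le_sq ?_ (by positivity)
    nlinarith [sq_nonneg (u * v' - u' * v)]
  have h1 : a * a * c < a * a * (u * v) := by gcongr
  have h2 : b * b * c < b * b * (u' * v') := by gcongr
  have h3 : a * b * (2 * c) ≤ a * b * (u * v' + u' * v) := by gcongr
  have h4 : c = a * a * c + a * b * (2 * c) + b * b * c := by
    rw [show a = 1 - b by linarith]; ring
  calc c = a * a * c + a * b * (2 * c) + b * b * c := h4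
    _ < a * a * (u * v) + a * b * (u * v' + u' * v) + b * b * (u' * v') := by linarith
    _ = _ := by ring

theorem convex_planeDomain : Convex ℝ planeDomain := by
  rw [convex_iff_forall_pos]
  rintro ⟨x, y⟩ ⟨⟨hx, hx1⟩, ⟨hy, hy1⟩, h⟩ ⟨x', y'⟩ ⟨⟨hx', hx1'⟩, ⟨hy', hy1'⟩, h'⟩ a b ha hb hab
  simp only at hx hx1 hy hy1 h hx' hx1' hy' hy1' h'
  have hmul := lt_mul_of_convex_comb (by norm_num) (sub_pos.2 hx1) (sub_pos.2 hy1)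
    (sub_pos.2 hx1') (sub_pos.2 hy1') h h' ha hb hab
  have ex : a * (1 - x) + b * (1 - x') = 1 - (a * x + b * x') := by linear_combination hab
  have ey : a * (1 - y) + b * (1 - y') = 1 - (a * y + b * y') := by linear_combination hab
  have px : 0 < a * (1 - x) + b * (1 - x') :=
    add_pos (mul_pos ha (sub_pos.2 hx1)) (mul_pos hb (sub_pos.2 hx1'))
  have py : 0 < a * (1 - y) + b * (1 - y') :=
    add_pos (mul_pos ha (sub_pos.2 hy1)) (mul_pos hb (sub_pos.2 hy1'))
  rw [ex, ey] at hmul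
  rw [ex] at px
  rw [ey] at py
  simp only [planeDomain, Set.mem_ofPred_eq, Prod.smul_mk, Prod.mk_add_mk, smul_eq_mul]
  exact ⟨⟨by positivity, sub_pos.1 px⟩, ⟨by positivity, sub_pos.1 py⟩, hmul⟩

/-- The second derivative of `f` in the direction `(a, b)`, up to a positive factor. -/
theorem quadForm_pos {x y a b : ℝ} (hp : (x, y) ∈ planeDomain) (hab : ¬(a = 0 ∧ b = 0)) :
    0 < (a * y) ^ 2 * (1 - y) + (a * y) * (b * x) + (b * x) ^ 2 * (1 - x) := by
  obtain ⟨⟨hx, hx1⟩, ⟨hy, hy1⟩, h⟩ := hp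
  simp only at hx hx1 hy hy1 h
  have hv : 0 < 1 - y := sub_pos.2 hy1
  refine pos_of_mul_pos_right (a := 1 - y) ?_ hv.le
  rw [show (1 - y) * ((a * y) ^ 2 * (1 - y) + (a * y) * (b * x) + (b * x) ^ 2 * (1 - x))
    = ((1 - y) * (a * y) + b * x / 2) ^ 2 + (b * x) ^ 2 * ((1 - x) * (1 - y) - 1 / 4) by ring]
  by_cases hb : b = 0
  · have ha : a ≠ 0 := fun ha => hab ⟨ha, hb⟩
    subst hb
    have : (1 - y) * (a * y) ≠ 0 := mul_ne_zero hv.ne' (mul_ne_zero ha hy.ne')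
    have := pow_pos (abs_pos.2 this) 2
    rw [sq_abs] at this
    simpa using this
  · have : b * x ≠ 0 := mul_ne_zero hb hx.ne'
    have h2 : 0 < (1 - x) * (1 - y) - 1 / 4 := sub_pos.2 h
    positivity

theorem strictConvexOn_planeF : StrictConvexOn ℝ planeDomain planeF := by
  refine ⟨convex_planeDomain, ?_⟩
  rintro ⟨x, y⟩ hp ⟨x', y'⟩ hq hne s t hs ht hst
  obtain ⟨a, rfl⟩ : ∃ a, x' = x + a := ⟨x' - x, by ring⟩
  obtain ⟨b, rfl⟩ : ∃ b, y' = y + b := ⟨y' - y, by ring⟩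
  have hab : ¬(a = 0 ∧ b = 0) := by
    rintro ⟨rfl, rfl⟩
    simp at hne
  -- It suffices to look at the restriction `φ` of `f` to the segment.
  let φ : ℝ → ℝ := fun r => planeF (x + r * a, y + r * b)
  let φ' : ℝ → ℝ := fun r =>
    -a / (x + r * a) ^ 2 * ((1 - (y + r * b)) / (y + r * b))
      + (1 - (x + r * a)) / (x + r * a) * (-b / (y + r * b) ^ 2)
  have hmem : ∀ r ∈ Set.Icc (0 : ℝ) 1, (x + r * a, y + r * b) ∈ planeDomain := by
    rintro r ⟨h0, h1⟩
    have := convex_planeDomain hp hq (sub_nonneg.2 h1) h0 (sub_add_cancel 1 r)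
    simp only [Prod.smul_mk, Prod.mk_add_mk, smul_eq_mul] at this
    convert this using 2 <;> ring
  have hline : ∀ c e r : ℝ, HasDerivAt (fun r => c + r * e) e r := fun c e r => by
    simpa using ((hasDerivAt_id r).mul_const e).const_add c
  have hσ : ∀ c e r : ℝ, c + r * e ≠ 0 →
      HasDerivAt (fun r => (1 - (c + r * e)) / (c + r * e)) (-e / (c + r * e) ^ 2) r := by
    intro c e r h
    refine (((hline c e r).const_sub 1).div (hline c e r) h).congr_deriv ?_
    congr 1
    ring
  have hinv : ∀ c e r : ℝ, c + r * e ≠ 0 →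
      HasDerivAt (fun r => -e / (c + r * e) ^ 2) (2 * e ^ 2 / (c + r * e) ^ 3) r := by
    intro c e r h
    refine ((hasDerivAt_const r (-e)).div ((hline c e r).pow 2) (pow_ne_zero 2 h)).congr_deriv ?_
    simp only [Pi.pow_apply]
    field_simp
    ring
  have hφ : ∀ r ∈ Set.Icc (0 : ℝ) 1, HasDerivAt φ (φ' r) r := fun r hr =>
    (hσ x a r (hmem r hr).1.1.ne').mul (hσ y b r (hmem r hr).2.1.1.ne')
  have hφ' : ∀ r ∈ Set.Icc (0 : ℝ) 1, ∃ m, 0 < m ∧ HasDerivAt φ' m r := by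
    intro r hr
    have hm := hmem r hr
    have hX : 0 < x + r * a := hm.1.1
    have hY : 0 < y + r * b := hm.2.1.1
    refine ⟨_, ?_, ((hinv x a r hX.ne').mul (hσ y b r hY.ne')).add
      ((hσ x a r hX.ne').mul (hinv y b r hY.ne'))⟩
    have key := quadForm_pos hm hab
    generalize x + r * a = X at *
    generalize y + r * b = Y at *
    rw [show 2 * a ^ 2 / X ^ 3 * ((1 - Y) / Y) + -a / X ^ 2 * (-b / Y ^ 2)
        + (-a / X ^ 2 * (-b / Y ^ 2) + (1 - X) / X * (2 * b ^ 2 / Y ^ 3))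
      = 2 / (X ^ 3 * Y ^ 3)
        * ((a * Y) ^ 2 * (1 - Y) + (a * Y) * (b * X) + (b * X) ^ 2 * (1 - X)) by
      field_simp; ring]
    positivity
  have hmono : StrictMonoOn φ' (Set.Icc 0 1) := by
    refine strictMonoOn_of_deriv_pos (convex_Icc 0 1) (fun r hr => ?_) (fun r hr => ?_)
    · obtain ⟨m, -, h⟩ := hφ' r hr
      exact h.continuousAt.continuousWithinAt
    · obtain ⟨m, hm, h⟩ := hφ' r (interior_subset hr)
      rwa [h.deriv]
  have hconv : StrictConvexOn ℝ (Set.Icc 0 1) φ := by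
    refine StrictMonoOn.strictConvexOn_of_deriv (convex_Icc 0 1)
      (fun r hr => (hφ r hr).continuousAt.continuousWithinAt) ?_
    intro r hr r' hr' hlt
    rw [(hφ r (interior_subset hr)).deriv, (hφ r' (interior_subset hr')).deriv]
    exact hmono (interior_subset hr) (interior_subset hr') hlt
  have := hconv.2 (Set.left_mem_Icc.2 zero_le_one) (Set.right_mem_Icc.2 zero_le_one)
    zero_ne_one hs ht hst
  obtain rfl : s = 1 - t := by linarith
  simp only [φ, smul_eq_mul, Prod.smul_mk, Prod.mk_add_mk] at this ⊢
  convert this using 2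
  · congr 1 <;> ring
  · simp
  · simp

theorem planeRegionF_subset_planeDomain : planeRegionF ⊆ planeDomain := by
  rintro ⟨x, y⟩ ⟨⟨hxy, hx, hy⟩, h⟩
  simp only at hxy hx hy h
  refine ⟨⟨hx, by linarith⟩, ⟨hy, by linarith⟩, ?_⟩
  have h1 : √2 < 1.415 := by rw [Real.sqrt_lt' (by norm_num)]; norm_num
  have h0 : 1.414 < √2 := by rw [Real.lt_sqrt (by norm_num)]; norm_num
  -- The line `7 x + 6.68 y = 4.415` bounds a slightly larger triangle with rational data.
  have h2 : 7 * x + 6.68 * y < 4.415 := by nlinarith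
  simp only
  nlinarith

theorem convex_triangle : Convex ℝ triangle := by
  rw [convex_iff_forall_pos]
  rintro ⟨x, y⟩ ⟨h, hx, hy⟩ ⟨x', y'⟩ ⟨h', hx', hy'⟩ a b ha hb hab
  simp only at h hx hy h' hx' hy'
  simp only [triangle, Set.mem_ofPred_eq, Prod.smul_mk, Prod.mk_add_mk, smul_eq_mul]
  have h1 : a * (x + y) < a * 1 := by gcongr
  have h2 : b * (x' + y') < b * 1 := by gcongr
  exact ⟨by linarith, by positivity, by positivity⟩

theorem convex_planeRegionF : Convex ℝ planeRegionF := by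
  refine convex_triangle.inter ?_
  have : IsLinearMap ℝ fun p : ℝ × ℝ => 7 * p.1 + (18 - 8 * √2) * p.2 :=
    ⟨fun p q => by simp; ring, fun c p => by simp; ring⟩
  exact convex_halfSpace_lt this _

/-- The shear `(x, y) ↦ (x + y, y)`, which turns `g` into `f`. -/
def shear : ℝ × ℝ →ₗ[ℝ] ℝ × ℝ :=
  (LinearMap.fst ℝ ℝ ℝ + LinearMap.snd ℝ ℝ ℝ).prod (LinearMap.snd ℝ ℝ ℝ)

theorem shear_apply (p : ℝ × ℝ) : shear p = (p.1 + p.2, p.2) := rfl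

theorem shear_injective : Function.Injective shear := by
  rintro ⟨x, y⟩ ⟨x', y'⟩ h
  simp only [shear_apply, Prod.mk.injEq] at h ⊢
  exact ⟨by linarith, h.2⟩

theorem planeG_eq (p : ℝ × ℝ) : planeG p = planeF (shear p) := by
  simp only [planeG, planeF, shear_apply, sub_sub]

theorem planeRegionG_eq : planeRegionG = triangle ∩ shear ⁻¹' planeDomain := by
  ext ⟨x, y⟩
  simp only [planeRegionG, triangle, planeDomain, shear_apply, Set.mem_ofPred_eq, Set.mem_inter_iff,
    Set.mem_preimage]
  refine and_congr_right fun ⟨h, hx, hy⟩ => ⟨fun hq => ?_, fun hq => ?_⟩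
  · exact ⟨⟨by linarith, h⟩, ⟨hy, by linarith⟩, by linarith⟩
  · linarith [hq.2.2]

/-- Strict convexity passes to the composition with a linear map, as long as the images differ. -/
theorem comp_convex_comb_lt {E : Type*} [AddCommGroup E] [Module ℝ E] {s : Set (ℝ × ℝ)}
    {φ : ℝ × ℝ → ℝ} (h : StrictConvexOn ℝ s φ) (L : E →ₗ[ℝ] ℝ × ℝ) {x y : E} (hx : L x ∈ s)
    (hy : L y ∈ s) (hne : L x ≠ L y) {a b : ℝ} (ha : 0 < a) (hb : 0 < b) (hab : a + b = 1) :
    φ (L (a • x + b • y)) < a * φ (L x) + b * φ (L y) := by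
  simpa using h.2 hx hy hne ha hb hab

theorem strictConvexOn_planeRegionF : StrictConvexOn ℝ planeRegionF planeF :=
  strictConvexOn_planeF.subset planeRegionF_subset_planeDomain convex_planeRegionF

theorem strictConvexOn_planeRegionG : StrictConvexOn ℝ planeRegionG planeG := by
  rw [planeRegionG_eq]
  refine ⟨convex_triangle.inter (convex_planeDomain.linear_preimage shear), ?_⟩
  intro p hp q hq hne a b ha hb hab
  rw [planeG_eq, planeG_eq, planeG_eq]
  exact comp_convex_comb_lt strictConvexOn_planeF shear hp.2 hq.2 (shear_injective.ne hne) ha hb hab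

/-! ### Blocks and block sums -/

variable {k : ℕ}

theorem blockOf_cases (i : Fin (dim k)) :
    blockOf i = 1 ∨ blockOf i = 2 ∨ blockOf i = 3 ∨ blockOf i = 4 := by
  unfold blockOf
  split_ifs <;> simp

theorem card_block {j : ℕ} (hj : 1 ≤ j) (hj' : j ≤ 4) : (block k j).card = 3 ^ (k - 1) := by
  have hn : (j - 1) * 3 ^ (k - 1) + 3 ^ (k - 1) = j * 3 ^ (k - 1) := by
    rw [← Nat.succ_mul, Nat.succ_eq_add_one, Nat.sub_add_cancel hj]
  have hle : j * 3 ^ (k - 1) ≤ 4 * 3 ^ (k - 1) := Nat.mul_le_mul_right _ hj'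
  have : (block k j).card = (Finset.Ioc ((j - 1) * 3 ^ (k - 1)) (j * 3 ^ (k - 1))).card := by
    refine Finset.card_bij (fun i _ => label i) ?_ ?_ ?_
    · intro i hi
      simpa [block] using hi
    · intro i _ i' _ h
      simp only [label] at h
      exact Fin.ext (by omega)
    · intro m hm
      rw [Finset.mem_Ioc] at hm
      have hlt : m - 1 < dim k := by
        show m - 1 < 4 * 3 ^ (k - 1)
        omega
      have hlabel : label (⟨m - 1, hlt⟩ : Fin (dim k)) = m := by
        show m - 1 + 1 = m
        omega
      refine ⟨⟨m - 1, hlt⟩, ?_, hlabel⟩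
      simp only [block, Finset.mem_filter, Finset.mem_univ, true_and, hlabel]
      exact hm
  rw [this, Nat.card_Ioc]
  omega

theorem card_block_blockOf (i : Fin (dim k)) : (block k (blockOf i)).card = 3 ^ (k - 1) := by
  refine card_block ?_ ?_ <;> rcases blockOf_cases i with h | h | h | h <;> omega

/-- The four blocks partition the index set. -/
theorem sum_blockSum (x : Fin (dim k) → ℝ) :
    blockSum k 1 x + blockSum k 2 x + blockSum k 3 x + blockSum k 4 x = ∑ i, x i := by
  simp only [blockSum, block, Finset.sum_filter, ← Finset.sum_add_distrib]
  refine Finset.sum_congr rfl fun i _ => ?_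
  have h1 : 1 ≤ label i := Nat.le_add_left _ _
  have h4 : label i ≤ 4 * 3 ^ (k - 1) := i.isLt
  split_ifs <;> first | omega | simp

theorem sum_range_four_mul_mod (c : ℕ → ℝ) (n : ℕ) :
    ∑ m ∈ Finset.range (4 * n), c ((m + 1) % 4) = n * (c 0 + c 1 + c 2 + c 3) := by
  induction n with
  | zero => simp
  | succ n ih =>
    rw [show 4 * (n + 1) = 4 * n + 1 + 1 + 1 + 1 by ring]
    simp only [Finset.sum_range_succ, ih]
    rw [show (4 * n + 1) % 4 = 1 by omega, show (4 * n + 1 + 1) % 4 = 2 by omega,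
      show (4 * n + 1 + 1 + 1) % 4 = 3 by omega, show (4 * n + 1 + 1 + 1 + 1) % 4 = 0 by omega]
    push_cast
    ring

/-- Each of the four blocks enters the formulas of exactly `3 ^ (k - 1)` functions `f_i`. -/
theorem sum_blockOf (φ : ℕ → ℝ) :
    ∑ i : Fin (dim k), φ (blockOf i) = 3 ^ (k - 1) * (φ 1 + φ 2 + φ 3 + φ 4) := by
  have := sum_range_four_mul_mod
    (fun r => φ (if r = 0 then 1 else if r = 1 then 4 else if r = 2 then 3 else 2)) (3 ^ (k - 1))
  rw [← Fin.sum_univ_eq_sum_range (fun m => φ (if (m + 1) % 4 = 0 then 1 else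
    if (m + 1) % 4 = 1 then 4 else if (m + 1) % 4 = 2 then 3 else 2))] at this
  refine Eq.trans this ?_
  norm_num
  ring

theorem sum_add_lt_one {x : Fin (dim k) → ℝ} (hx : x ∈ simplex k) (i : Fin (dim k))
    {s : Finset (Fin (dim k))} (hi : i ∉ s) (hs : s.card + 1 < 4 * 3 ^ (k - 1)) :
    ∑ l ∈ s, x l + x i < 1 := by
  rw [add_comm, ← Finset.sum_insert hi, ← hx.2]
  obtain ⟨m, -, hm⟩ : ∃ m ∈ Finset.univ, m ∉ insert i s := by
    refine Finset.exists_mem_notMem_of_card_lt_card ?_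
    rw [Finset.card_insert_of_notMem hi, Finset.card_univ, Fintype.card_fin]
    exact hs
  exact Finset.sum_lt_sum_of_subset (Finset.subset_univ _) (Finset.mem_univ m) hm (hx.1 m)
    fun l _ _ => (hx.1 l).le

theorem blockSum_pos {x : Fin (dim k) → ℝ} (hx : x ∈ simplex k) (i : Fin (dim k)) :
    0 < blockSum k (blockOf i) x := by
  refine Finset.sum_pos (fun l _ => hx.1 l) (Finset.card_pos.1 ?_)
  rw [card_block_blockOf]
  positivity

theorem blockSum_lt_one {x : Fin (dim k) → ℝ} (hx : x ∈ simplex k) (i : Fin (dim k)) :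
    blockSum k (blockOf i) x < 1 := by
  have hn : 0 < 3 ^ (k - 1) := by positivity
  obtain ⟨m, -, hm⟩ : ∃ m ∈ Finset.univ, m ∉ block k (blockOf i) := by
    refine Finset.exists_mem_notMem_of_card_lt_card ?_
    rw [card_block_blockOf, Finset.card_univ, Fintype.card_fin]
    show 3 ^ (k - 1) < 4 * 3 ^ (k - 1)
    omega
  rw [← hx.2]
  exact Finset.sum_lt_sum_of_subset (Finset.subset_univ _) (Finset.mem_univ m) hm (hx.1 m)
    fun l _ _ => (hx.1 l).le

theorem blockSumErase_add {i : Fin (dim k)} {j : ℕ} (hi : i ∈ block k j) (x : Fin (dim k) → ℝ) :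
    blockSumErase k j i x + x i = blockSum k j x :=
  Finset.sum_erase_add _ _ hi

theorem three_le_pow (hk : 2 ≤ k) : 3 ≤ 3 ^ (k - 1) :=
  Nat.le_self_pow (by omega) 3

theorem mem_triangle_of_notMem {i : Fin (dim k)} (hi : i ∉ block k (blockOf i))
    {x : Fin (dim k) → ℝ} (hx : x ∈ simplex k) : (blockSum k (blockOf i) x, x i) ∈ triangle := by
  refine ⟨sum_add_lt_one hx i hi ?_, blockSum_pos hx i, hx.1 i⟩
  have hn : 0 < 3 ^ (k - 1) := by positivity
  rw [card_block_blockOf]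
  omega

theorem mem_triangle_of_mem (hk : 2 ≤ k) {i : Fin (dim k)} (hi : i ∈ block k (blockOf i))
    {x : Fin (dim k) → ℝ} (hx : x ∈ simplex k) :
    (blockSumErase k (blockOf i) i x, x i) ∈ triangle := by
  refine ⟨?_, ?_, hx.1 i⟩
  · show blockSumErase k (blockOf i) i x + x i < 1
    rw [blockSumErase_add hi]
    exact blockSum_lt_one hx i
  · have := three_le_pow hk
    show 0 < ∑ l ∈ (block k (blockOf i)).erase i, x l
    refine Finset.sum_pos (fun l _ => hx.1 l) (Finset.card_pos.1 ?_)
    rw [Finset.card_erase_of_mem hi, card_block_blockOf]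
    omega

/-! ### Convexity of the displacement functions -/

theorem disp_eq_planeF (i : Fin (dim k)) (x : Fin (dim k) → ℝ) :
    disp k i x = planeF (blockSum k (blockOf i) x, x i) := rfl

theorem disp_eq_planeG {i : Fin (dim k)} (hi : i ∈ block k (blockOf i)) (x : Fin (dim k) → ℝ) :
    disp k i x = planeG (blockSumErase k (blockOf i) i x, x i) := by
  rw [disp_eq_planeF, planeG_eq, shear_apply, blockSumErase_add hi]

theorem mem_region_iff_planeRegionF {i : Fin (dim k)} (hi : i ∉ block k (blockOf i))
    {x : Fin (dim k) → ℝ} (hx : x ∈ simplex k) :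
    x ∈ region k i ↔ (blockSum k (blockOf i) x, x i) ∈ planeRegionF := by
  rw [region, if_neg hi]
  exact and_congr_left fun _ => iff_of_true hx (mem_triangle_of_notMem hi hx)

theorem mem_region_iff_planeRegionG (hk : 2 ≤ k) {i : Fin (dim k)} (hi : i ∈ block k (blockOf i))
    {x : Fin (dim k) → ℝ} (hx : x ∈ simplex k) :
    x ∈ region k i ↔ (blockSumErase k (blockOf i) i x, x i) ∈ planeRegionG := by
  rw [region, if_pos hi]
  exact and_congr_left fun _ => iff_of_true hx (mem_triangle_of_mem hk hi hx)

theorem region_subset_simplex (i : Fin (dim k)) : region k i ⊆ simplex k := by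
  intro x hx
  unfold region at hx
  split_ifs at hx <;> exact hx.1

theorem convex_simplex : Convex ℝ (simplex k) := by
  rw [convex_iff_forall_pos]
  intro x hx y hy a b ha hb hab
  refine ⟨fun i => add_pos (mul_pos ha (hx.1 i)) (mul_pos hb (hy.1 i)), ?_⟩
  simp only [Pi.add_apply, Pi.smul_apply, smul_eq_mul, Finset.sum_add_distrib, ← Finset.mul_sum]
  rw [hx.2, hy.2, mul_one, mul_one, hab]

/-- The linear map `x ↦ (∑ l ∈ s, x_l, x_i)`. -/
def sumProj (s : Finset (Fin (dim k))) (i : Fin (dim k)) : (Fin (dim k) → ℝ) →ₗ[ℝ] ℝ × ℝ :=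
  (∑ l ∈ s, LinearMap.proj l).prod (LinearMap.proj i)

theorem sumProj_apply (s : Finset (Fin (dim k))) (i : Fin (dim k)) (x : Fin (dim k) → ℝ) :
    sumProj s i x = (∑ l ∈ s, x l, x i) := by
  simp [sumProj]

/-- Each `f_i` and its region are pulled back, along a linear map, from a strictly convex function
on a planar set; points with the same image under that map have the same `(Σ_j(x), x_i)`. -/
theorem exists_linear_factor (hk : 2 ≤ k) (i : Fin (dim k)) :
    ∃ (L : (Fin (dim k) → ℝ) →ₗ[ℝ] ℝ × ℝ) (s : Set (ℝ × ℝ)) (φ : ℝ × ℝ → ℝ),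
      StrictConvexOn ℝ s φ ∧ (∀ x, disp k i x = φ (L x)) ∧
      region k i = simplex k ∩ L ⁻¹' s ∧
      ∀ x y, L x = L y →
        (blockSum k (blockOf i) x, x i) = (blockSum k (blockOf i) y, y i) := by
  by_cases hi : i ∈ block k (blockOf i)
  · refine ⟨sumProj ((block k (blockOf i)).erase i) i, planeRegionG, planeG,
      strictConvexOn_planeRegionG, fun x => ?_, ?_, fun x y h => ?_⟩
    · rw [sumProj_apply]
      exact disp_eq_planeG hi x
    · ext x
      rw [Set.mem_inter_iff, Set.mem_preimage, sumProj_apply]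
      exact ⟨fun hx => ⟨region_subset_simplex i hx,
          (mem_region_iff_planeRegionG hk hi (region_subset_simplex i hx)).1 hx⟩,
        fun hx => (mem_region_iff_planeRegionG hk hi hx.1).2 hx.2⟩
    · rw [sumProj_apply, sumProj_apply, Prod.mk.injEq] at h
      rw [← blockSumErase_add hi, ← blockSumErase_add hi, blockSumErase, blockSumErase, h.1, h.2]
  · refine ⟨sumProj (block k (blockOf i)) i, planeRegionF, planeF,
      strictConvexOn_planeRegionF, fun x => ?_, ?_, fun x y h => ?_⟩
    · rw [sumProj_apply]
      rfl
    · ext x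
      rw [Set.mem_inter_iff, Set.mem_preimage, sumProj_apply]
      exact ⟨fun hx => ⟨region_subset_simplex i hx,
          (mem_region_iff_planeRegionF hi (region_subset_simplex i hx)).1 hx⟩,
        fun hx => (mem_region_iff_planeRegionF hi hx.1).2 hx.2⟩
    · rwa [sumProj_apply, sumProj_apply] at h

theorem convexOn_disp (hk : 2 ≤ k) (i : Fin (dim k)) : ConvexOn ℝ (region k i) (disp k i) := by
  obtain ⟨L, s, φ, hφ, hd, hr, -⟩ := exists_linear_factor hk i
  rw [funext hd, hr]
  exact (hφ.convexOn.comp_linearMap L).subset Set.inter_subset_right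
    (convex_simplex.inter (hφ.1.linear_preimage L))

theorem disp_convex_comb_lt (hk : 2 ≤ k) (i : Fin (dim k)) {x y : Fin (dim k) → ℝ}
    (hx : x ∈ region k i) (hy : y ∈ region k i)
    (hne : (blockSum k (blockOf i) x, x i) ≠ (blockSum k (blockOf i) y, y i)) {a b : ℝ}
    (ha : 0 < a) (hb : 0 < b) (hab : a + b = 1) :
    disp k i (a • x + b • y) < a * disp k i x + b * disp k i y := by
  obtain ⟨L, s, φ, hφ, hd, hr, hL⟩ := exists_linear_factor hk i
  rw [hr] at hx hy
  rw [hd, hd, hd]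
  exact comp_convex_comb_lt hφ L hx.2 hy.2 (fun h => hne (hL x y h)) ha hb hab

/-! ### The minimiser -/

/-- The point of the simplex with all coordinates equal. -/
noncomputable def barycentre (k : ℕ) : Fin (dim k) → ℝ := fun _ => 1 / (4 * 3 ^ (k - 1))

theorem barycentre_mem_simplex : barycentre k ∈ simplex k := by
  refine ⟨fun i => by unfold barycentre; positivity, ?_⟩
  simp only [barycentre, Finset.sum_const, Finset.card_univ, Fintype.card_fin, nsmul_eq_mul]
  push_cast
  field_simp

theorem blockSum_barycentre (i : Fin (dim k)) :
    blockSum k (blockOf i) (barycentre k) = 1 / 4 := by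
  simp only [blockSum, barycentre, Finset.sum_const, card_block_blockOf, nsmul_eq_mul]
  push_cast
  field_simp

theorem disp_barycentre (i : Fin (dim k)) :
    disp k i (barycentre k) = 12 * 3 ^ (k - 1) - 3 := by
  rw [disp, blockSum_barycentre]
  simp only [sigma, barycentre]
  field_simp
  ring

theorem maxDisp_barycentre : maxDisp k (barycentre k) = 12 * 3 ^ (k - 1) - 3 := by
  simp only [maxDisp, disp_barycentre, Finset.sup'_const]

/-- A bound `σ(S) σ(t) ≤ 12 n - 3` forces `t ≥ (1 - S) / (1 + (12 n - 4) S)`. The right side is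
strictly convex in `S`, and the bound below is its tangent line at `S = 1 / 4`. -/
theorem tangent_le_of_sigma_mul_le {n S t : ℝ} (hn : 1 ≤ n) (hS : 0 < S) (ht : 0 < t)
    (h : sigma S * sigma t ≤ 12 * n - 3) :
    1 / (4 * n) - (4 * n - 1) / (3 * n ^ 2) * (S - 1 / 4) ≤ t ∧
      (t = 1 / (4 * n) - (4 * n - 1) / (3 * n ^ 2) * (S - 1 / 4) → S = 1 / 4) := by
  have hn0 : 0 < n := by linarith
  have h1 : (1 - S) * (1 - t) ≤ (12 * n - 3) * (S * t) := by
    rw [sigma, sigma, div_mul_div_comm, div_le_iff₀ (mul_pos hS ht)] at h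
    exact h
  set c := (4 * n - 1) / (3 * n ^ 2) with hc
  have hcpos : 0 < c := div_pos (by linarith) (by positivity)
  have hβ : 0 < 12 * n - 4 := by linarith
  have hpos : 0 < 1 + (12 * n - 4) * S := by positivity
  have hid : 1 - S = (1 + (12 * n - 4) * S) * (1 / (4 * n) - c * (S - 1 / 4))
      + c * (12 * n - 4) * (S - 1 / 4) ^ 2 := by
    rw [hc]
    field_simp
    ring
  have hmain : c * (12 * n - 4) * (S - 1 / 4) ^ 2
      ≤ (1 + (12 * n - 4) * S) * (t - (1 / (4 * n) - c * (S - 1 / 4))) := by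
    linarith
  refine ⟨?_, fun he => ?_⟩
  · have : 0 ≤ (1 + (12 * n - 4) * S) * (t - (1 / (4 * n) - c * (S - 1 / 4))) :=
      le_trans (by positivity) hmain
    exact sub_nonneg.1 (nonneg_of_mul_nonneg_right this hpos)
  · rw [he, sub_self, mul_zero] at hmain
    have h0 : (S - 1 / 4) ^ 2 ≤ 0 :=
      nonpos_of_mul_nonpos_right hmain (mul_pos hcpos hβ)
    exact sub_eq_zero.1 (pow_eq_zero_iff two_ne_zero |>.1 (le_antisymm h0 (sq_nonneg _)))

theorem eq_barycentre_of_maxDisp_le {x : Fin (dim k) → ℝ} (hx : x ∈ simplex k)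
    (h : maxDisp k x ≤ 12 * 3 ^ (k - 1) - 3) : x = barycentre k := by
  have hn : (1 : ℝ) ≤ 3 ^ (k - 1) := one_le_pow₀ (by norm_num)
  set n : ℝ := 3 ^ (k - 1) with hndef
  let τ : ℕ → ℝ := fun j =>
    1 / (4 * n) - (4 * n - 1) / (3 * n ^ 2) * (blockSum k j x - 1 / 4)
  have hτ : ∀ i, τ (blockOf i) ≤ x i ∧ (x i = τ (blockOf i) → blockSum k (blockOf i) x = 1 / 4) :=
    fun i => tangent_le_of_sigma_mul_le hn (blockSum_pos hx i) (hx.1 i)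
      ((Finset.le_sup' (fun i => disp k i x) (Finset.mem_univ i)).trans h)
  have hsum : ∑ i : Fin (dim k), τ (blockOf i) = ∑ i, x i := by
    have hblocks := sum_blockSum x
    rw [hx.2] at hblocks ⊢
    rw [sum_blockOf τ, ← hndef]
    have : τ 1 + τ 2 + τ 3 + τ 4 = 1 / n := by
      have h4 : τ 1 + τ 2 + τ 3 + τ 4 = 4 * (1 / (4 * n)) - (4 * n - 1) / (3 * n ^ 2)
          * (blockSum k 1 x + blockSum k 2 x + blockSum k 3 x + blockSum k 4 x - 1) := by
        simp only [τ]; ring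
      rw [h4, hblocks]
      field_simp
      ring
    rw [this]
    field_simp
  have heq := (Finset.sum_eq_sum_iff_of_le fun i _ => (hτ i).1).1 hsum
  funext i
  have hi : x i = τ (blockOf i) := (heq i (Finset.mem_univ i)).symm
  have hS := (hτ i).2 hi
  rw [hi]
  simp only [τ, hS, barycentre, sub_self, mul_zero, sub_zero, hndef]

theorem isLeast_maxDisp :
    IsLeast (maxDisp k '' simplex k) (12 * 3 ^ (k - 1) - 3) := by
  refine ⟨⟨barycentre k, barycentre_mem_simplex, maxDisp_barycentre⟩, ?_⟩
  rintro _ ⟨x, hx, rfl⟩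
  by_contra! hlt
  have := eq_barycentre_of_maxDisp_le hx hlt.le
  rw [this, maxDisp_barycentre] at hlt
  exact lt_irrefl _ hlt

theorem infMaxDisp_eq : infMaxDisp k = 12 * 3 ^ (k - 1) - 3 :=
  isLeast_maxDisp.csInf_eq

theorem barycentre_mem_region (hk : 2 ≤ k) (i : Fin (dim k)) : barycentre k ∈ region k i := by
  have hn : (3 : ℝ) ≤ 3 ^ (k - 1) := by exact_mod_cast three_le_pow hk
  have hle : barycentre k i ≤ 1 / 12 := by
    unfold barycentre
    gcongr
    linarith
  have hpos : 0 < barycentre k i := barycentre_mem_simplex.1 i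
  unfold region
  split_ifs with hi
  · refine ⟨barycentre_mem_simplex, ?_⟩
    have hS := blockSumErase_add hi (barycentre k)
    rw [blockSum_barycentre] at hS
    rw [eq_sub_of_add_eq hS]
    linarith
  · refine ⟨barycentre_mem_simplex, ?_⟩
    rw [blockSum_barycentre]
    have h1 : 1 < √2 := by rw [Real.lt_sqrt (by norm_num)]; norm_num
    nlinarith

end Displacement

theorem mainTheorem5 (k : ℕ) (hk : 2 ≤ k) :
    -- the infimum of `F^k` over the simplex is attained
    IsLeast (Displacement.maxDisp k '' Displacement.simplex k) (Displacement.infMaxDisp k) ∧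
    -- every minimiser lies in the intersection of the regions `C_{f_i}`
    (∀ x ∈ Displacement.simplex k, Displacement.maxDisp k x = Displacement.infMaxDisp k →
      x ∈ ⋂ i, Displacement.region k i) ∧
    -- if `i ∉ I_j`, then `f_i = f(Σ_j, x_i)` and `C_{f_i}` is the preimage of `C_f`
    (∀ i, i ∉ Displacement.block k (Displacement.blockOf i) → ∀ x ∈ Displacement.simplex k,
      Displacement.disp k i x
        = Displacement.planeF (Displacement.blockSum k (Displacement.blockOf i) x, x i) ∧
      (x ∈ Displacement.region k i ↔
        (Displacement.blockSum k (Displacement.blockOf i) x, x i)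
          ∈ Displacement.planeRegionF)) ∧
    -- if `i ∈ I_j`, then `f_i = g(Σ_j^i, x_i)` and `C_{f_i}` is the preimage of `C_g`
    (∀ i, i ∈ Displacement.block k (Displacement.blockOf i) → ∀ x ∈ Displacement.simplex k,
      Displacement.disp k i x
        = Displacement.planeG (Displacement.blockSumErase k (Displacement.blockOf i) i x, x i) ∧
      (x ∈ Displacement.region k i ↔
        (Displacement.blockSumErase k (Displacement.blockOf i) i x, x i)
          ∈ Displacement.planeRegionG)) ∧
    -- `f` and `g` are strictly convex on `C_f` and `C_g`
    StrictConvexOn ℝ Displacement.planeRegionF Displacement.planeF ∧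
    StrictConvexOn ℝ Displacement.planeRegionG Displacement.planeG ∧
    -- `f_i` is convex on the convex set `C_{f_i}`, and strictly so in `(Σ_j, x_i)`
    (∀ i, ConvexOn ℝ (Displacement.region k i) (Displacement.disp k i) ∧
      ∀ x ∈ Displacement.region k i, ∀ y ∈ Displacement.region k i,
        (Displacement.blockSum k (Displacement.blockOf i) x, x i)
          ≠ (Displacement.blockSum k (Displacement.blockOf i) y, y i) →
        ∀ a b : ℝ, 0 < a → 0 < b → a + b = 1 →
          Displacement.disp k i (a • x + b • y)
            < a * Displacement.disp k i x + b * Displacement.disp k i y) ∧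
    -- the minimiser is unique
    (∀ x ∈ Displacement.simplex k, ∀ y ∈ Displacement.simplex k,
      Displacement.maxDisp k x = Displacement.infMaxDisp k →
      Displacement.maxDisp k y = Displacement.infMaxDisp k → x = y) := by
  have hmin : ∀ x ∈ Displacement.simplex k,
      Displacement.maxDisp k x = Displacement.infMaxDisp k → x = Displacement.barycentre k :=
    fun x hx h => Displacement.eq_barycentre_of_maxDisp_le hx
      (h.trans Displacement.infMaxDisp_eq).le
  refine ⟨?_, fun x hx h => ?_, fun i hi x hx => ⟨rfl, ?_⟩, fun i hi x hx => ⟨?_, ?_⟩,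
    Displacement.strictConvexOn_planeRegionF, Displacement.strictConvexOn_planeRegionG,
    fun i => ⟨Displacement.convexOn_disp hk i, fun x hx y hy hne a b ha hb hab => ?_⟩,
    fun x hx y hy h h' => (hmin x hx h).trans (hmin y hy h').symm⟩
  · rw [Displacement.infMaxDisp_eq]
    exact Displacement.isLeast_maxDisp
  · rw [hmin x hx h]
    exact Set.mem_iInter.2 (Displacement.barycentre_mem_region hk)
  · exact Displacement.mem_region_iff_planeRegionF hi hx
  · exact Displacement.disp_eq_planeG hi x
  · exact Displacement.mem_region_iff_planeRegionG hk hi hx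
  · exact Displacement.disp_convex_comb_lt hk i hx hy hne ha hb hab
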